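/- For real $s>0$ let $\eta(s)=\sum_{i=1}^{\infty}\frac{(-1)^{i-1}}{i^{s}}$ (limit of partial sums) be the Dirichlet eta function; in particular $\eta(1)=\ln 2$. For $n\ge 0$ put $$B_n=\frac{2}{7}\pi^2\sum_{j=1}^{n}\frac{\eta(j)}{(j+1)(j+2)},\qquad A_n=\frac{2}{7}\pi^2\Bigl(\frac{\eta(n+1)}{n+2}+\sum_{j=1}^{n}\frac{\eta(j)}{(j+1)(j+2)}\Bigr).$$ Then $$\zeta(3)=\lim_{n\to\infty}A_n=\frac{2}{7}\pi^2\sum_{j=1}^{\infty}\frac{\eta(j)}{(j+1)(j+2)},$$ where the series on the right converges (absolutely). Moreover the first formula converges faster than the second: $B_n\neq\zeta(3)$ for all $n$, and $$\lim_{n\to\infty}\frac{A_n-\zeta(3)}{B_n-\zeta(3)}=0 .$$ -/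

import Mathlib

open Filter Topology Asymptotics

/-- The `n`-th partial sum `∑_{i=1}^{n} (-1)^(i-1) / i^s` of the alternating series of the
Dirichlet eta function (the summation index is shifted by one). -/
noncomputable def etaPartial (s : ℝ) (n : ℕ) : ℝ :=
  ∑ i ∈ Finset.range n, (-1 : ℝ) ^ i / ((i : ℝ) + 1) ^ s

/-- The Dirichlet eta function `η(s) = ∑_{i ≥ 1} (-1)^(i-1) / i^s` for real `s > 0`. The series
is only conditionally convergent for `s ≤ 1`, so it is the limit of its partial sums. -/
noncomputable def dirichletEta (s : ℝ) : ℝ :=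
  limUnder atTop (etaPartial s)

/-- For `s > 0` the defining series converges to `dirichletEta s`. -/
theorem tendsto_etaPartial {s : ℝ} (hs : 0 < s) :
    Tendsto (etaPartial s) atTop (𝓝 (dirichletEta s)) := by
  have hanti : Antitone (fun i : ℕ => (((i : ℝ) + 1) ^ s)⁻¹) := by
    intro a b hab
    have h : (a : ℝ) ≤ b := by exact_mod_cast hab
    have ha : (0 : ℝ) < (a : ℝ) + 1 := by positivity
    exact inv_anti₀ (Real.rpow_pos_of_pos ha s)
      (Real.rpow_le_rpow ha.le (by linarith) hs.le)
  have hzero : Tendsto (fun i : ℕ => (((i : ℝ) + 1) ^ s)⁻¹) atTop (𝓝 0) :=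
    tendsto_inv_atTop_zero.comp ((tendsto_rpow_atTop hs).comp
      (tendsto_atTop_add_const_right _ _ tendsto_natCast_atTop_atTop))
  obtain ⟨l, hl⟩ := hanti.tendsto_alternating_series_of_tendsto_zero hzero
  have hl' : Tendsto (etaPartial s) atTop (𝓝 l) := by
    have h : etaPartial s =
        fun n => ∑ i ∈ Finset.range n, (-1 : ℝ) ^ i * (((i : ℝ) + 1) ^ s)⁻¹ := by
      funext n
      simp only [etaPartial, div_eq_mul_inv]
    rw [h]
    exact hl
  exact tendsto_nhds_limUnder ⟨l, hl'⟩

/-- The `n`-th approximation `(2/7) π² ∑_{j=1}^{n} η(j) / ((j+1)(j+2))`. -/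
noncomputable def plainApprox (n : ℕ) : ℝ :=
  2 / 7 * Real.pi ^ 2 *
    ∑ j ∈ Finset.Icc 1 n, 1 / (((j : ℝ) + 1) * ((j : ℝ) + 2)) * dirichletEta j

/-- The `n`-th approximation with boundary term,
`(2/7) π² (η(n+1) / (n+2) + ∑_{j=1}^{n} η(j) / ((j+1)(j+2)))`. -/
noncomputable def boundaryApprox (n : ℕ) : ℝ :=
  2 / 7 * Real.pi ^ 2 *
    (1 / ((n : ℝ) + 2) * dirichletEta ((n : ℝ) + 1) +
      ∑ j ∈ Finset.Icc 1 n, 1 / (((j : ℝ) + 1) * ((j : ℝ) + 2)) * dirichletEta j)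

/-! The weight `1/((j+1)(j+2))` is the integral of `t^j (1-t)` over `[0,1]`, and `G(t) = ∑ η(j)
t^(j-1)` equals `∑ (-1)^i/(i+1-t)`. Symmetrizing under `t ↦ 1-t`, the partial fractions of cosecant
give `G(t) + G(1-t) = π / sin(πt)` (`tsum_dirichletEta_add_reflected`), so twice the series is the
integral of `t(1-t) π / sin(πt)`. Expanding `t(1-t)` in the sines `sin((2k+1)πt)`, with coefficients
`8/(π(2k+1))^3`, leaves Dirichlet kernels of integral 1, hence `(8/π²) ∑ 1/(2k+1)^3 = 7ζ(3)/π²`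
(`integral_mul_csc`).

For the rates, the weights beyond `n` telescope to `1/(n+2)`. As `η ≥ 1/2`, the plain error is at
least of order `1/n`; the boundary term replaces each omitted `η(j)` by `η(n+1)`, which differs from
it by at most `2^(-n)`. -/

/-! ### Alternating series bounds for eta -/

theorem etaPartial_natCast (k n : ℕ) :
    etaPartial k n = ∑ i ∈ Finset.range n, (-1 : ℝ) ^ i * (1 / ((i : ℝ) + 1) ^ k) := by
  simp only [etaPartial, Real.rpow_natCast, mul_one_div]

theorem tendsto_etaPartial_natCast {k : ℕ} (hk : k ≠ 0) :
    Tendsto (fun n => ∑ i ∈ Finset.range n, (-1 : ℝ) ^ i * (1 / ((i : ℝ) + 1) ^ k)) atTop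
      (𝓝 (dirichletEta k)) := by
  have h := tendsto_etaPartial (s := k) (by positivity)
  simpa only [← etaPartial_natCast] using h

theorem antitone_one_div_add_one_pow (k : ℕ) :
    Antitone (fun i : ℕ => 1 / ((i : ℝ) + 1) ^ k) := by
  intro a b hab
  have h : (a : ℝ) ≤ b := by exact_mod_cast hab
  dsimp only
  gcongr

theorem dirichletEta_le_one {k : ℕ} (hk : k ≠ 0) : dirichletEta k ≤ 1 := by
  simpa using (antitone_one_div_add_one_pow k).tendsto_le_alternating_series
    (tendsto_etaPartial_natCast hk) 0

theorem one_sub_le_dirichletEta {k : ℕ} (hk : k ≠ 0) : 1 - (1 / 2) ^ k ≤ dirichletEta k := by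
  have h := (antitone_one_div_add_one_pow k).alternating_series_le_tendsto
    (tendsto_etaPartial_natCast hk) 1
  norm_num [Finset.sum_range_succ] at h
  rw [one_div, inv_pow]
  linarith

theorem half_le_dirichletEta {k : ℕ} (hk : k ≠ 0) : 1 / 2 ≤ dirichletEta k := by
  have h : ((1 : ℝ) / 2) ^ k ≤ 1 / 2 := pow_le_of_le_one (by norm_num) (by norm_num) hk
  linarith [one_sub_le_dirichletEta hk]

/-- Uniformity in `n` is what dominated convergence needs for the generating function. -/
theorem abs_sum_alternating_le {f : ℕ → ℝ} (hf : Antitone f) (h0 : ∀ i, 0 ≤ f i) (n : ℕ) :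
    |∑ i ∈ Finset.range n, (-1 : ℝ) ^ i * f i| ≤ f 0 := by
  -- Two consecutive sums are carried together: the next one lies between them.
  have key : ∀ n, (0 ≤ ∑ i ∈ Finset.range n, (-1 : ℝ) ^ i * f i ∧
      ∑ i ∈ Finset.range n, (-1 : ℝ) ^ i * f i ≤ f 0) ∧
      (0 ≤ ∑ i ∈ Finset.range n, (-1 : ℝ) ^ i * f i + (-1) ^ n * f n ∧
      ∑ i ∈ Finset.range n, (-1 : ℝ) ^ i * f i + (-1) ^ n * f n ≤ f 0) := by
    intro n
    induction n with
    | zero => simp [h0]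
    | succ n ih =>
      obtain ⟨⟨h1, h2⟩, h3, h4⟩ := ih
      have hn := hf (Nat.le_succ n)
      have hp := h0 (n + 1)
      have hq := h0 n
      rw [Finset.sum_range_succ, pow_succ]
      rcases neg_one_pow_eq_or ℝ n with h | h <;> rw [h] at h3 h4 ⊢ <;>
        refine ⟨⟨h3, h4⟩, ?_, ?_⟩ <;> simp only [Nat.succ_eq_add_one] at hn <;> linarith
  rw [abs_of_nonneg (key n).1.1]
  exact (key n).1.2

theorem dirichletEta_one : dirichletEta 1 = Real.log 2 := by
  have h : Tendsto (fun n => ∑ i ∈ Finset.range n, (-1 : ℝ) ^ i * (1 / ((i : ℝ) + 1)))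
      atTop (𝓝 (dirichletEta 1)) := by
    simpa using tendsto_etaPartial_natCast one_ne_zero
  -- Abel's limit theorem; `x` times the power series is `log (1 + x)`.
  have habel := Real.tendsto_tsum_powerSeries_nhdsWithin_lt h
  have hid : Tendsto (fun x : ℝ => x) (𝓝[<] 1) (𝓝 1) := nhdsWithin_le_nhds
  have h1 := hid.mul habel
  have h2 : Tendsto (fun x : ℝ => Real.log (1 + x)) (𝓝[<] 1) (𝓝 (Real.log (1 + 1))) :=
    (hid.const_add 1).log (by norm_num)
  rw [one_mul] at h1
  rw [one_add_one_eq_two] at h2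
  refine tendsto_nhds_unique (h1.congr' ?_) h2
  filter_upwards [Ioo_mem_nhdsLT (zero_lt_one (α := ℝ))] with x hx
  have hs := (Real.hasSum_pow_div_log_of_abs_lt_one (x := -x)
    (by rw [abs_neg, abs_of_pos hx.1]; exact hx.2)).neg
  rw [neg_neg, sub_neg_eq_add] at hs
  rw [← hs.tsum_eq, ← tsum_mul_left]
  refine tsum_congr fun n => ?_
  rw [neg_pow x (n + 1)]
  ring

/-! ### Generating function and reflection identity -/

/-- The partial sums of `∑ (-1)^i / (i + 1 - t)` converge to the generating function of `η`. -/
theorem tendsto_sum_alternating_div_sub {t : ℝ} (h0 : 0 < t) (h1 : t < 1) :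
    Tendsto (fun n => ∑ i ∈ Finset.range n, (-1 : ℝ) ^ i / ((i : ℝ) + 1 - t)) atTop
      (𝓝 (∑' j : ℕ, dirichletEta ((j + 1 : ℕ) : ℝ) * t ^ j)) := by
  have hdom : Tendsto (fun n => ∑' j : ℕ, etaPartial ((j + 1 : ℕ) : ℝ) n * t ^ j) atTop
      (𝓝 (∑' j : ℕ, dirichletEta ((j + 1 : ℕ) : ℝ) * t ^ j)) := by
    refine tendsto_tsum_of_dominated_convergence (bound := fun j => t ^ j)
      (summable_geometric_of_lt_one h0.le h1) (fun j => ?_) (.of_forall fun n j => ?_)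
    · exact (tendsto_etaPartial (by positivity)).mul_const _
    · rw [norm_mul, Real.norm_eq_abs, Real.norm_of_nonneg (by positivity), etaPartial_natCast]
      have := abs_sum_alternating_le (antitone_one_div_add_one_pow (j + 1))
        (fun i => by positivity) n
      refine mul_le_of_le_one_left (by positivity) (by simpa using this)
  refine hdom.congr fun n => HasSum.tsum_eq ?_
  simp only [etaPartial_natCast, Finset.sum_mul]
  refine hasSum_sum fun i _ => ?_
  have hi : (0 : ℝ) < (i : ℝ) + 1 := by positivity
  have hlt : t / (i + 1) < 1 := by
    rw [div_lt_one hi]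
    have : (0 : ℝ) ≤ i := by positivity
    linarith
  have hg := (hasSum_geometric_of_lt_one (by positivity) hlt).mul_left ((-1 : ℝ) ^ i / (i + 1))
  have hne : (i : ℝ) + 1 - t ≠ 0 := by
    have : (0 : ℝ) ≤ i := by positivity
    linarith
  have e1 : (fun j : ℕ => (-1 : ℝ) ^ i * (1 / ((i : ℝ) + 1) ^ (j + 1)) * t ^ j) =
      fun j => (-1 : ℝ) ^ i / (i + 1) * (t / (i + 1)) ^ j := by
    funext j
    rw [div_pow, pow_succ]
    field_simp
  have e2 : (-1 : ℝ) ^ i / (i + 1 - t) = (-1 : ℝ) ^ i / (i + 1) * (1 - t / (i + 1))⁻¹ := by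
    rw [one_sub_div hi.ne']
    field_simp
  rw [e1, e2]
  exact hg

theorem tendsto_sum_cotTerm {x : ℝ} (h0 : 0 < x) (h1 : x < 1) :
    Tendsto (fun n => ∑ j ∈ Finset.range n, (1 / (x - (j + 1)) + 1 / (x + (j + 1)))) atTop
      (𝓝 (Real.pi * Real.cot (Real.pi * x) - 1 / x)) := by
  have hx : (x : ℂ) ∈ Complex.integerComplement := by
    rintro ⟨n, hn⟩
    have hn' : (n : ℝ) = x := by exact_mod_cast hn
    rw [← hn'] at h0 h1
    have : 0 < n := by exact_mod_cast h0
    have : n < 1 := by exact_mod_cast h1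
    omega
  have h := (Complex.continuous_re.tendsto _).comp (tendsto_logDeriv_euler_cot_sub hx)
  convert h using 1
  · funext n
    have : ∑ j ∈ Finset.range n, cotTerm x j =
        ((∑ j ∈ Finset.range n, (1 / (x - (j + 1)) + 1 / (x + (j + 1))) : ℝ) : ℂ) := by
      push_cast [cotTerm]; rfl
    simp only [Function.comp, this, Complex.ofReal_re]
  · have : (Real.pi : ℂ) * Complex.cot (Real.pi * x) - 1 / x =
        ((Real.pi * Real.cot (Real.pi * x) - 1 / x : ℝ) : ℂ) := by push_cast; rfl
    rw [this, Complex.ofReal_re]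

/-- The lengths `2M` and `2M+1` make the poles run over the symmetric window from `-2M` to `2M`. The
limit comes from `cot(x/2) - cot x = 1 / sin x`. -/
theorem tendsto_sum_alternating_add_reflected {t : ℝ} (h0 : 0 < t) (h1 : t < 1) :
    Tendsto (fun M : ℕ => ∑ i ∈ Finset.range (2 * M), (-1 : ℝ) ^ i / ((i : ℝ) + 1 - t) +
      ∑ i ∈ Finset.range (2 * M + 1), (-1 : ℝ) ^ i / ((i : ℝ) + 1 - (1 - t))) atTop
      (𝓝 (Real.pi / Real.sin (Real.pi * t))) := by
  have hA := tendsto_sum_cotTerm (x := t / 2) (by linarith) (by linarith)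
  have hB := (tendsto_sum_cotTerm h0 h1).comp
    (tendsto_id.const_mul_atTop' (r := 2) (by norm_num) : Tendsto (fun M : ℕ => 2 * M) atTop atTop)
  -- The cotangent limits carry `-2/t` and `+1/t`, so adding `1/t` cancels the poles at 0.
  have hC := (hA.sub hB).const_add (1 / t)
  convert hC using 1
  · funext M
    simp only [Function.comp]
    induction M with
    | zero => simp
    | succ M ih =>
      rw [show 2 * (M + 1) = 2 * M + 1 + 1 by ring]
      rw [Finset.sum_range_succ _ (2 * M + 1 + 1), Finset.sum_range_succ _ (2 * M + 1),
        Finset.sum_range_succ _ (2 * M)]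
      conv_rhs => rw [Finset.sum_range_succ _ M, Finset.sum_range_succ _ (2 * M + 1),
        Finset.sum_range_succ _ (2 * M)]
      rw [Finset.sum_range_succ _ (2 * M + 1)]
      have e0 : (-1 : ℝ) ^ (2 * M) = 1 := by rw [pow_mul]; simp
      have e1 : (-1 : ℝ) ^ (2 * M + 1) = -1 := by rw [pow_succ, e0]; simp
      have e2 : (-1 : ℝ) ^ (2 * M + 1 + 1) = 1 := by rw [pow_succ, e1]; simp
      have a1 : 1 / (t / 2 - ((M : ℝ) + 1)) = 2 * (1 / (t - (2 * M + 2))) := by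
        rw [show t / 2 - ((M : ℝ) + 1) = (t - (2 * M + 2)) / 2 by ring]
        simp [div_eq_mul_inv]
      have a2 : 1 / (t / 2 + ((M : ℝ) + 1)) = 2 * (1 / (t + (2 * M + 2))) := by
        rw [show t / 2 + ((M : ℝ) + 1) = (t + (2 * M + 2)) / 2 by ring]
        simp [div_eq_mul_inv]
      have b1 : (1 : ℝ) / (2 * M + 1 - t) = - (1 / (t - (2 * M + 1))) := by
        rw [← one_div_neg_eq_neg_one_div]; ring_nf
      have b2 : (1 : ℝ) / (2 * M + 1 + 1 - t) = - (1 / (t - (2 * M + 1 + 1))) := by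
        rw [← one_div_neg_eq_neg_one_div]; ring_nf
      push_cast
      rw [e0, e1, e2, a1, a2, neg_div, neg_div, b1, b2]
      rw [show (2 * (M : ℝ) + 2) = 2 * M + 1 + 1 by ring,
        show (2 * (M : ℝ) + 1 + 1 - (1 - t)) = t + (2 * M + 1) by ring,
        show (2 * (M : ℝ) + 1 + 1 + 1 - (1 - t)) = t + (2 * M + 1 + 1) by ring]
      linear_combination ih
  · congr 1
    have hs : Real.sin (Real.pi * t / 2) ≠ 0 :=
      (Real.sin_pos_of_pos_of_lt_pi (by positivity) (by nlinarith [Real.pi_pos])).ne'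
    have hc : Real.cos (Real.pi * t / 2) ≠ 0 :=
      (Real.cos_pos_of_mem_Ioo ⟨by nlinarith [Real.pi_pos], by nlinarith [Real.pi_pos]⟩).ne'
    rw [Real.cot_eq_cos_div_sin, Real.cot_eq_cos_div_sin,
      show Real.pi * (t / 2) = Real.pi * t / 2 by ring,
      show Real.pi * t = 2 * (Real.pi * t / 2) by ring, Real.sin_two_mul, Real.cos_two_mul,
      show 2 * (Real.pi * t / 2) / 2 = Real.pi * t / 2 by ring]
    field_simp
    ring

theorem tsum_dirichletEta_add_reflected {t : ℝ} (h0 : 0 < t) (h1 : t < 1) :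
    ∑' j : ℕ, dirichletEta ((j + 1 : ℕ) : ℝ) * t ^ j +
      ∑' j : ℕ, dirichletEta ((j + 1 : ℕ) : ℝ) * (1 - t) ^ j =
      Real.pi / Real.sin (Real.pi * t) := by
  have hM : Tendsto (fun M : ℕ => 2 * M) atTop atTop :=
    tendsto_id.const_mul_atTop' (r := 2) (by norm_num)
  have hA := (tendsto_sum_alternating_div_sub h0 h1).comp hM
  have hB := (tendsto_sum_alternating_div_sub (t := 1 - t) (by linarith) (by linarith)).comp
    ((tendsto_add_atTop_nat 1).comp hM)
  exact tendsto_nhds_unique (hA.add hB) (tendsto_sum_alternating_add_reflected h0 h1)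

/-! ### From the series to a cosecant integral -/

theorem integral_pow_succ_mul_one_sub (j : ℕ) :
    ∫ t in (0 : ℝ)..1, t ^ (j + 1) * (1 - t) = 1 / (((j : ℝ) + 2) * (j + 3)) := by
  have h : ∀ t : ℝ, t ^ (j + 1) * (1 - t) = t ^ (j + 1) - t ^ (j + 2) := fun t => by ring
  simp only [h]
  rw [intervalIntegral.integral_sub (by simp) (by simp), integral_pow, integral_pow]
  have h2 : (j : ℝ) + 2 ≠ 0 := by positivity
  have h3 : (j : ℝ) + 3 ≠ 0 := by positivity
  push_cast
  rw [show (j : ℝ) + 1 + 1 = j + 2 by ring, show (j : ℝ) + 2 + 1 = j + 3 by ring]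
  simp
  field_simp
  ring

theorem integral_symmetrized_pow (j : ℕ) :
    ∫ t in Set.Ioo (0 : ℝ) 1, (t ^ (j + 1) * (1 - t) + (1 - t) ^ (j + 1) * t) =
      2 * (1 / (((j : ℝ) + 2) * (j + 3))) := by
  rw [← MeasureTheory.integral_Ioc_eq_integral_Ioo,
    ← intervalIntegral.integral_of_le zero_le_one,
    intervalIntegral.integral_add (Continuous.intervalIntegrable (by fun_prop) _ _)
      (Continuous.intervalIntegrable (by fun_prop) _ _)]
  have h := intervalIntegral.integral_comp_sub_left (a := 0) (b := 1)
    (fun t : ℝ => t ^ (j + 1) * (1 - t)) 1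
  simp only [sub_sub_cancel, sub_self, sub_zero] at h
  rw [h, integral_pow_succ_mul_one_sub]
  ring

/-- Each term is `1/(m+2) - 1/(m+3)` with `m = j+n`. This serves both summability and the error
estimates. -/
theorem hasSum_telescoping (n : ℕ) :
    HasSum (fun j : ℕ => 1 / (((j + n : ℕ) + 2 : ℝ) * ((j + n : ℕ) + 3))) (1 / ((n : ℝ) + 2)) := by
  rw [hasSum_iff_tendsto_nat_of_nonneg fun j => by positivity]
  have h : ∀ N : ℕ, ∑ j ∈ Finset.range N, 1 / (((j + n : ℕ) + 2 : ℝ) * ((j + n : ℕ) + 3)) =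
      1 / ((n : ℝ) + 2) - 1 / ((N + n : ℕ) + 2) := by
    intro N
    induction N with
    | zero => simp
    | succ N ih =>
      rw [Finset.sum_range_succ, ih]
      push_cast
      have h2 : (N : ℝ) + n + 2 ≠ 0 := by positivity
      have h3 : (N : ℝ) + n + 3 ≠ 0 := by positivity
      rw [show (N : ℝ) + 1 + n + 2 = N + n + 3 by ring]
      field_simp
      ring
  simp only [h]
  have hz : Tendsto (fun N : ℕ => 1 / (((N + n : ℕ) : ℝ) + 2)) atTop (𝓝 0) := by
    refine Tendsto.div_atTop tendsto_const_nhds ?_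
    exact tendsto_atTop_add_const_right _ _
      (tendsto_natCast_atTop_atTop.comp (tendsto_add_atTop_nat n))
  simpa using hz.const_sub (1 / ((n : ℝ) + 2))

theorem summable_dirichletEta_mul :
    Summable fun j : ℕ => 1 / (((j : ℝ) + 2) * (j + 3)) * dirichletEta ((j + 1 : ℕ) : ℝ) := by
  refine Summable.of_nonneg_of_le (fun j => ?_) (fun j => ?_) (hasSum_telescoping 0).summable
  · have := half_le_dirichletEta (Nat.succ_ne_zero j)
    have : 0 ≤ dirichletEta ((j + 1 : ℕ) : ℝ) := by linarith
    positivity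
  · exact mul_le_of_le_one_right (by positivity) (dirichletEta_le_one (Nat.succ_ne_zero j))

/-- All terms are nonnegative on the interval, so the norms have the same summable integrals and sum
and integral may be exchanged. -/
theorem two_mul_tsum_eq_integral :
    2 * ∑' j : ℕ, 1 / (((j : ℝ) + 2) * (j + 3)) * dirichletEta ((j + 1 : ℕ) : ℝ) =
      ∫ t in Set.Ioo (0 : ℝ) 1, t * (1 - t) * (Real.pi / Real.sin (Real.pi * t)) := by
  set F : ℕ → ℝ → ℝ := fun j t =>
    dirichletEta ((j + 1 : ℕ) : ℝ) * (t ^ (j + 1) * (1 - t) + (1 - t) ^ (j + 1) * t) with hF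
  have hint : ∀ j, ∫ t in Set.Ioo (0 : ℝ) 1, F j t =
      2 * (1 / (((j : ℝ) + 2) * (j + 3)) * dirichletEta ((j + 1 : ℕ) : ℝ)) := by
    intro j
    rw [MeasureTheory.integral_const_mul, integral_symmetrized_pow]
    ring
  have hnorm : ∀ j, ∫ t in Set.Ioo (0 : ℝ) 1, ‖F j t‖ =
      2 * (1 / (((j : ℝ) + 2) * (j + 3)) * dirichletEta ((j + 1 : ℕ) : ℝ)) := by
    intro j
    rw [← hint]
    refine MeasureTheory.setIntegral_congr_fun measurableSet_Ioo fun t ht => ?_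
    have := half_le_dirichletEta (Nat.succ_ne_zero j)
    have h0 : 0 ≤ dirichletEta ((j + 1 : ℕ) : ℝ) := by linarith
    have h1 : 0 ≤ 1 - t := by linarith [ht.2]
    have h2 := ht.1.le
    exact Real.norm_of_nonneg (by positivity)
  have h := MeasureTheory.hasSum_integral_of_summable_integral_norm (F := F)
    (μ := MeasureTheory.volume.restrict (Set.Ioo (0 : ℝ) 1))
    (fun j => (Continuous.integrableOn_Icc (by fun_prop)).mono_set Set.Ioo_subset_Icc_self)
    (by simp only [hnorm]; exact summable_dirichletEta_mul.mul_left 2)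
  simp only [hint] at h
  rw [← tsum_mul_left, h.tsum_eq]
  refine MeasureTheory.setIntegral_congr_fun measurableSet_Ioo fun t ht => ?_
  have hsum : ∀ u : ℝ, 0 < u → u < 1 →
      Summable fun j : ℕ => dirichletEta ((j + 1 : ℕ) : ℝ) * u ^ j := by
    intro u hu0 hu1
    refine Summable.of_norm_bounded (summable_geometric_of_lt_one hu0.le hu1) fun j => ?_
    have := half_le_dirichletEta (Nat.succ_ne_zero j)
    rw [Real.norm_of_nonneg (mul_nonneg (by linarith) (by positivity))]
    exact mul_le_of_le_one_left (by positivity) (dirichletEta_le_one (Nat.succ_ne_zero j))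
  have hA := hsum t ht.1 ht.2
  have hB := hsum (1 - t) (by linarith [ht.2]) (by linarith [ht.1])
  rw [← tsum_dirichletEta_add_reflected ht.1 ht.2, ← hA.tsum_add hB, ← tsum_mul_left]
  refine tsum_congr fun j => ?_
  simp only [hF]
  ring

/-! ### Fourier sine series of `t(1-t)` -/

theorem bernoulli_three_eval (x : ℝ) :
    (Polynomial.map (algebraMap ℚ ℝ) (Polynomial.bernoulli 3)).eval x =
      x ^ 3 - 3 / 2 * x ^ 2 + x / 2 := by
  have h3 : bernoulli 3 = 0 := bernoulli_eq_zero_of_odd (by decide) (by norm_num)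
  rw [Polynomial.bernoulli_def]
  simp [Finset.sum_range_succ, h3, Nat.choose]
  ring

theorem hasSum_sin_div_cube {x : ℝ} (hx : x ∈ Set.Icc (0 : ℝ) 1) :
    HasSum (fun n : ℕ => 1 / (n : ℝ) ^ 3 * Real.sin (2 * Real.pi * n * x))
      (2 * Real.pi ^ 3 / 3 * (x ^ 3 - 3 / 2 * x ^ 2 + x / 2)) := by
  have h := hasSum_one_div_nat_pow_mul_sin one_ne_zero hx
  rw [show 2 * 1 + 1 = 3 from rfl, bernoulli_three_eval] at h
  convert h using 1
  rw [show Nat.factorial 3 = 6 from rfl]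
  push_cast
  ring

/-- A sum over odd naturals as the full sum minus the sum over even naturals. -/
theorem HasSum.odd_of_even {f : ℕ → ℝ} {a b : ℝ} (h : HasSum f a)
    (he : HasSum (fun k => f (2 * k)) b) : HasSum (fun k => f (2 * k + 1)) (a - b) := by
  have hs : Summable fun k => f (2 * k + 1) :=
    h.summable.comp_injective fun m n hmn => by simpa using hmn
  have := (he.even_add_odd hs.hasSum).unique h
  rw [← this, add_sub_cancel_left]
  exact hs.hasSum

/-- In the cubic Bernoulli series at `t/2`, the even-indexed terms form `1/8` of the series at `t`;
subtracting them cancels the cubic part. -/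
theorem hasSum_sin_odd_div_cube {t : ℝ} (ht : t ∈ Set.Icc (0 : ℝ) 1) :
    HasSum (fun k : ℕ => 1 / (2 * k + 1 : ℝ) ^ 3 * Real.sin ((2 * k + 1) * (Real.pi * t)))
      (Real.pi ^ 3 / 8 * (t * (1 - t))) := by
  have h1 := hasSum_sin_div_cube (x := t / 2) ⟨by linarith [ht.1], by linarith [ht.2]⟩
  have h2 := (hasSum_sin_div_cube ht).mul_left (1 / 8)
  have h3 : HasSum (fun k : ℕ => 1 / ((2 * k : ℕ) : ℝ) ^ 3 *
      Real.sin (2 * Real.pi * (2 * k : ℕ) * (t / 2)))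
      (1 / 8 * (2 * Real.pi ^ 3 / 3 * (t ^ 3 - 3 / 2 * t ^ 2 + t / 2))) := by
    have e : (fun k : ℕ => 1 / ((2 * k : ℕ) : ℝ) ^ 3 *
        Real.sin (2 * Real.pi * (2 * k : ℕ) * (t / 2))) =
        fun k : ℕ => 1 / 8 * (1 / (k : ℝ) ^ 3 * Real.sin (2 * Real.pi * k * t)) := by
      funext k
      rw [show 2 * Real.pi * ((2 * k : ℕ) : ℝ) * (t / 2) = 2 * Real.pi * k * t by push_cast; ring,
        ← mul_assoc, one_div_mul_one_div]
      push_cast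
      rw [mul_pow]
      norm_num
    rw [e]
    exact h2
  convert h1.odd_of_even h3 using 1
  · funext k
    push_cast
    ring_nf
  · ring

theorem hasSum_one_div_odd_cube :
    HasSum (fun k : ℕ => 1 / (2 * k + 1 : ℝ) ^ 3) (7 / 8 * ∑' n : ℕ, 1 / (n : ℝ) ^ 3) := by
  have hz : HasSum (fun n : ℕ => 1 / (n : ℝ) ^ 3) (∑' n : ℕ, 1 / (n : ℝ) ^ 3) :=
    (Real.summable_one_div_nat_pow.2 (by norm_num)).hasSum
  have he : (fun k : ℕ => 1 / ((2 * k : ℕ) : ℝ) ^ 3) = fun k : ℕ => 1 / 8 * (1 / (k : ℝ) ^ 3) := by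
    funext k
    push_cast
    rw [mul_pow, one_div_mul_one_div]
    norm_num
  have h := hz.odd_of_even (by rw [he]; exact hz.mul_left (1 / 8))
  push_cast at h
  convert h using 1
  ring

/-! ### Dirichlet kernels and the cosecant integral -/

theorem sin_odd_div_sin_succ (k : ℕ) {x : ℝ} (hx : Real.sin x ≠ 0) :
    Real.sin ((2 * (k + 1 : ℕ) + 1) * x) / Real.sin x =
      Real.sin ((2 * k + 1) * x) / Real.sin x + 2 * Real.cos ((2 * k + 2) * x) := by
  have e1 : (2 * ((k + 1 : ℕ) : ℝ) + 1) * x = (2 * k + 2) * x + x := by push_cast; ring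
  have e2 : (2 * (k : ℝ) + 1) * x = (2 * k + 2) * x - x := by ring
  rw [e1, e2, Real.sin_add, Real.sin_sub]
  field_simp
  ring

theorem sin_pi_mul_ne_zero_of_mem_Ioo {t : ℝ} (ht : t ∈ Set.Ioo (0 : ℝ) 1) :
    Real.sin (Real.pi * t) ≠ 0 :=
  (Real.sin_pos_of_pos_of_lt_pi (mul_pos Real.pi_pos ht.1)
    (mul_lt_of_lt_one_right Real.pi_pos ht.2)).ne'

/-- Each induction step adds a cosine of integral zero. -/
theorem integrableOn_and_integral_sin_odd_div_sin (k : ℕ) :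
    MeasureTheory.IntegrableOn
      (fun t : ℝ => Real.sin ((2 * k + 1) * (Real.pi * t)) / Real.sin (Real.pi * t))
      (Set.Ioo 0 1) ∧
    ∫ t in Set.Ioo (0 : ℝ) 1,
      Real.sin ((2 * k + 1) * (Real.pi * t)) / Real.sin (Real.pi * t) = 1 := by
  induction k with
  | zero =>
    have h : Set.EqOn (fun t : ℝ => Real.sin ((2 * (0 : ℕ) + 1) * (Real.pi * t)) /
        Real.sin (Real.pi * t)) (fun _ => 1) (Set.Ioo 0 1) := by
      intro t ht
      simp [div_self (sin_pi_mul_ne_zero_of_mem_Ioo ht)]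
    constructor
    · rw [MeasureTheory.integrableOn_congr_fun h measurableSet_Ioo]
      simp
    · rw [MeasureTheory.setIntegral_congr_fun measurableSet_Ioo h]
      simp
  | succ k ih =>
    have h : Set.EqOn (fun t : ℝ => Real.sin ((2 * (k + 1 : ℕ) + 1) * (Real.pi * t)) /
        Real.sin (Real.pi * t)) (fun t => Real.sin ((2 * k + 1) * (Real.pi * t)) /
          Real.sin (Real.pi * t) + 2 * Real.cos ((2 * k + 2) * (Real.pi * t))) (Set.Ioo 0 1) :=
      fun t ht => sin_odd_div_sin_succ k (sin_pi_mul_ne_zero_of_mem_Ioo ht)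
    have hcos : MeasureTheory.IntegrableOn
        (fun t : ℝ => 2 * Real.cos ((2 * k + 2) * (Real.pi * t))) (Set.Ioo 0 1) :=
      (Continuous.integrableOn_Icc (by fun_prop)).mono_set Set.Ioo_subset_Icc_self
    constructor
    · rw [MeasureTheory.integrableOn_congr_fun h measurableSet_Ioo]
      exact ih.1.add hcos
    · rw [MeasureTheory.setIntegral_congr_fun measurableSet_Ioo h,
        MeasureTheory.integral_add ih.1 hcos, ih.2, MeasureTheory.integral_const_mul,
        ← MeasureTheory.integral_Ioc_eq_integral_Ioo,
        ← intervalIntegral.integral_of_le zero_le_one]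
      have hne : (2 * (k : ℝ) + 2) * Real.pi ≠ 0 := by positivity
      have := intervalIntegral.integral_comp_mul_left (a := 0) (b := 1) Real.cos hne
      simp only [mul_assoc] at this
      rw [this, integral_cos]
      have hs : Real.sin ((2 * (k : ℝ) + 2) * Real.pi) = 0 := by
        have := Real.sin_nat_mul_pi (2 * k + 2)
        push_cast at this
        exact this
      simp [hs]

theorem abs_sin_odd_div_sin_le (k : ℕ) {x : ℝ} (hx : Real.sin x ≠ 0) :
    |Real.sin ((2 * k + 1) * x) / Real.sin x| ≤ 2 * k + 1 := by
  induction k with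
  | zero => simp [div_self hx]
  | succ k ih =>
    rw [sin_odd_div_sin_succ k hx]
    refine (abs_add_le _ _).trans ?_
    rw [abs_mul, abs_two]
    have := Real.abs_cos_le_one ((2 * k + 2) * x)
    push_cast
    linarith

theorem integral_mul_csc :
    ∫ t in Set.Ioo (0 : ℝ) 1, t * (1 - t) * (Real.pi / Real.sin (Real.pi * t)) =
      7 / Real.pi ^ 2 * ∑' n : ℕ, 1 / (n : ℝ) ^ 3 := by
  set F : ℕ → ℝ → ℝ := fun k t => 8 / Real.pi ^ 2 * (1 / (2 * k + 1 : ℝ) ^ 3) *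
    (Real.sin ((2 * k + 1) * (Real.pi * t)) / Real.sin (Real.pi * t)) with hF
  have hint : ∀ k, ∫ t in Set.Ioo (0 : ℝ) 1, F k t =
      8 / Real.pi ^ 2 * (1 / (2 * k + 1 : ℝ) ^ 3) := by
    intro k
    rw [MeasureTheory.integral_const_mul, (integrableOn_and_integral_sin_odd_div_sin k).2, mul_one]
  have hFint : ∀ k, MeasureTheory.IntegrableOn (F k) (Set.Ioo 0 1) := fun k =>
    (integrableOn_and_integral_sin_odd_div_sin k).1.const_mul _
  -- The kernel bound `2k+1` costs one power, and the remaining inverse squares are still summable.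
  have hnorm : ∀ k, ∫ t in Set.Ioo (0 : ℝ) 1, ‖F k t‖ ≤
      8 / Real.pi ^ 2 * (1 / (2 * k + 1 : ℝ) ^ 2) := by
    intro k
    have hle : ∫ t in Set.Ioo (0 : ℝ) 1, ‖F k t‖ ≤
        ∫ _ in Set.Ioo (0 : ℝ) 1, 8 / Real.pi ^ 2 * (1 / (2 * k + 1 : ℝ) ^ 2) := by
      refine MeasureTheory.setIntegral_mono_on (hFint k).norm
        (MeasureTheory.integrableOn_const (by simp)) measurableSet_Ioo
        fun t ht => ?_
      rw [norm_mul, Real.norm_of_nonneg (by positivity)]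
      have := abs_sin_odd_div_sin_le k (sin_pi_mul_ne_zero_of_mem_Ioo ht)
      calc 8 / Real.pi ^ 2 * (1 / (2 * k + 1 : ℝ) ^ 3) * ‖_‖
          ≤ 8 / Real.pi ^ 2 * (1 / (2 * k + 1 : ℝ) ^ 3) * (2 * k + 1) := by
            gcongr
            exact this
        _ = _ := by
            field_simp
    simpa using hle
  have hsum : Summable fun k : ℕ => 8 / Real.pi ^ 2 * (1 / (2 * k + 1 : ℝ) ^ 2) := by
    refine Summable.mul_left _ ?_
    have h := (Real.summable_one_div_nat_pow (p := 2)).2 (by norm_num)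
    have := h.comp_injective (i := fun k : ℕ => 2 * k + 1) fun m n hmn => by simpa using hmn
    simpa [Function.comp_def] using this
  have h := MeasureTheory.hasSum_integral_of_summable_integral_norm (F := F)
    (μ := MeasureTheory.volume.restrict (Set.Ioo (0 : ℝ) 1)) hFint
    (Summable.of_nonneg_of_le (fun k => MeasureTheory.integral_nonneg fun t => norm_nonneg _)
      hnorm hsum)
  simp only [hint] at h
  have hval := h.unique (hasSum_one_div_odd_cube.mul_left (8 / Real.pi ^ 2))
  have hcongr : ∫ t in Set.Ioo (0 : ℝ) 1, t * (1 - t) * (Real.pi / Real.sin (Real.pi * t)) =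
      ∫ t in Set.Ioo (0 : ℝ) 1, ∑' k, F k t := by
    refine MeasureTheory.setIntegral_congr_fun measurableSet_Ioo fun t ht => ?_
    have hs := sin_pi_mul_ne_zero_of_mem_Ioo ht
    have := ((hasSum_sin_odd_div_cube (Set.Ioo_subset_Icc_self ht)).mul_left
      (8 / Real.pi ^ 2 / Real.sin (Real.pi * t))).tsum_eq
    calc t * (1 - t) * (Real.pi / Real.sin (Real.pi * t))
        = 8 / Real.pi ^ 2 / Real.sin (Real.pi * t) * (Real.pi ^ 3 / 8 * (t * (1 - t))) := by
          field_simp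
      _ = _ := by
          rw [← this]
          refine tsum_congr fun k => ?_
          simp only [hF]
          ring
  rw [hcongr, hval]
  ring

/-! ### The series for `ζ(3)` and convergence rates -/

theorem riemannZeta_three : riemannZeta 3 = ((∑' n : ℕ, 1 / (n : ℝ) ^ 3 : ℝ) : ℂ) := by
  have h := zeta_nat_eq_tsum_of_gt_one (k := 3) (by norm_num)
  push_cast at h ⊢
  exact h

theorem two_sevenths_pi_sq_mul_tsum :
    2 / 7 * Real.pi ^ 2 *
      ∑' j : ℕ, 1 / (((j : ℝ) + 2) * (j + 3)) * dirichletEta ((j + 1 : ℕ) : ℝ) =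
      ∑' n : ℕ, 1 / (n : ℝ) ^ 3 := by
  have h := two_mul_tsum_eq_integral.trans integral_mul_csc
  have hp := Real.pi_ne_zero
  rw [mul_comm 2, ← eq_div_iff two_ne_zero] at h
  rw [h]
  field_simp

theorem sum_Icc_eq_sum_range (n : ℕ) :
    ∑ j ∈ Finset.Icc 1 n, 1 / (((j : ℝ) + 1) * ((j : ℝ) + 2)) * dirichletEta j =
      ∑ j ∈ Finset.range n,
        1 / (((j : ℝ) + 2) * (j + 3)) * dirichletEta ((j + 1 : ℕ) : ℝ) := by
  induction n with
  | zero => simp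
  | succ n ih =>
    rw [Finset.sum_Icc_succ_top (by omega), ih, Finset.sum_range_succ]
    push_cast
    ring_nf

theorem hasSum_dirichletEta_tail (n : ℕ) :
    HasSum (fun j : ℕ => 1 / (((j + n : ℕ) + 2 : ℝ) * ((j + n : ℕ) + 3)) *
        dirichletEta ((j + n + 1 : ℕ) : ℝ))
      (∑' j : ℕ, 1 / (((j : ℝ) + 2) * (j + 3)) * dirichletEta ((j + 1 : ℕ) : ℝ) -
        ∑ j ∈ Finset.range n,
          1 / (((j : ℝ) + 2) * (j + 3)) * dirichletEta ((j + 1 : ℕ) : ℝ)) :=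
  (hasSum_nat_add_iff' n).2 summable_dirichletEta_mul.hasSum

theorem plainApprox_lower_bound (n : ℕ) :
    2 / 7 * Real.pi ^ 2 * (1 / (2 * ((n : ℝ) + 2))) ≤
      ∑' n : ℕ, 1 / (n : ℝ) ^ 3 - plainApprox n := by
  rw [← two_sevenths_pi_sq_mul_tsum, plainApprox, ← mul_sub, sum_Icc_eq_sum_range]
  refine mul_le_mul_of_nonneg_left ?_ (by positivity)
  have h := hasSum_le (fun j => ?_) ((hasSum_telescoping n).mul_right (1 / 2))
    (hasSum_dirichletEta_tail n)
  · rwa [one_div_mul_one_div, mul_comm _ (2 : ℝ)] at h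
  · exact mul_le_mul_of_nonneg_left (half_le_dirichletEta (Nat.succ_ne_zero _)) (by positivity)

theorem abs_boundaryApprox_sub_le (n : ℕ) :
    |boundaryApprox n - ∑' n : ℕ, 1 / (n : ℝ) ^ 3| ≤
      2 / 7 * Real.pi ^ 2 * (1 / ((n : ℝ) + 2) * (1 / 2) ^ n) := by
  rw [← two_sevenths_pi_sq_mul_tsum, boundaryApprox, ← mul_sub, sum_Icc_eq_sum_range, abs_mul,
    abs_of_pos (show (0 : ℝ) < 2 / 7 * Real.pi ^ 2 by positivity)]
  refine mul_le_mul_of_nonneg_left ?_ (by positivity)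
  have hT := hasSum_telescoping n
  -- Spreading the boundary term over the telescoping weights turns the error into one series of
  -- differences of eta values.
  have hd := (hT.mul_right (dirichletEta ((n : ℝ) + 1))).sub (hasSum_dirichletEta_tail n)
  have hb := hT.mul_right ((1 / 2) ^ n)
  -- Both values lie in `[1 - 2^(-(n+1)), 1]`.
  have hdiff : ∀ j : ℕ,
      |dirichletEta ((n : ℝ) + 1) - dirichletEta ((j + n + 1 : ℕ) : ℝ)| ≤ (1 / 2) ^ n := by
    intro j
    have h1 := dirichletEta_le_one (Nat.succ_ne_zero n)
    have h2 := one_sub_le_dirichletEta (Nat.succ_ne_zero n)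
    have h3 := dirichletEta_le_one (Nat.succ_ne_zero (j + n))
    have h4 := one_sub_le_dirichletEta (Nat.succ_ne_zero (j + n))
    have h5 : ((1 : ℝ) / 2) ^ (n + 1) ≤ (1 / 2) ^ n :=
      pow_le_pow_of_le_one (by norm_num) (by norm_num) (by omega)
    have h6 : ((1 : ℝ) / 2) ^ (j + n + 1) ≤ (1 / 2) ^ n :=
      pow_le_pow_of_le_one (by norm_num) (by norm_num) (by omega)
    simp only [Nat.succ_eq_add_one] at h1 h2 h3 h4
    rw [Nat.cast_add_one n] at h1 h2
    rw [abs_le]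
    constructor <;> linarith
  have hterm : ∀ j : ℕ, |1 / (((j + n : ℕ) + 2 : ℝ) * ((j + n : ℕ) + 3)) *
      dirichletEta ((n : ℝ) + 1) - 1 / (((j + n : ℕ) + 2 : ℝ) * ((j + n : ℕ) + 3)) *
        dirichletEta ((j + n + 1 : ℕ) : ℝ)| ≤
      1 / (((j + n : ℕ) + 2 : ℝ) * ((j + n : ℕ) + 3)) * (1 / 2) ^ n := by
    intro j
    rw [← mul_sub, abs_mul, abs_of_nonneg (by positivity)]
    exact mul_le_mul_of_nonneg_left (hdiff j) (by positivity)
  have hupper := hasSum_le (fun j => (abs_le.1 (hterm j)).2) hd hb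
  have hlower := hasSum_le (fun j => (abs_le.1 (hterm j)).1) hb.neg hd
  rw [abs_le]
  constructor <;> linarith

theorem tendsto_boundaryApprox :
    Tendsto boundaryApprox atTop (𝓝 (∑' n : ℕ, 1 / (n : ℝ) ^ 3)) := by
  rw [tendsto_iff_norm_sub_tendsto_zero]
  have hpow : Tendsto (fun n : ℕ => 2 / 7 * Real.pi ^ 2 * ((1 : ℝ) / 2) ^ n) atTop (𝓝 0) := by
    simpa using (tendsto_pow_atTop_nhds_zero_of_lt_one (r := (1 : ℝ) / 2) (by norm_num)
      (by norm_num)).const_mul (2 / 7 * Real.pi ^ 2)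
  refine squeeze_zero (fun n => norm_nonneg _) (fun n => ?_) hpow
  refine (abs_boundaryApprox_sub_le n).trans (mul_le_mul_of_nonneg_left ?_ (by positivity))
  refine mul_le_of_le_one_left (by positivity) ?_
  rw [div_le_one (by positivity)]
  have : (0 : ℝ) ≤ n := by positivity
  linarith

theorem boundaryApprox_sub_isLittleO :
    (fun n => boundaryApprox n - ∑' n : ℕ, 1 / (n : ℝ) ^ 3) =o[atTop]
      (fun n => plainApprox n - ∑' n : ℕ, 1 / (n : ℝ) ^ 3) := by
  have hpow : (fun n : ℕ => 2 * ((1 : ℝ) / 2) ^ n) =o[atTop] (fun _ => (1 : ℝ)) := by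
    rw [isLittleO_one_iff]
    simpa using (tendsto_pow_atTop_nhds_zero_of_lt_one (r := (1 : ℝ) / 2) (by norm_num)
      (by norm_num)).const_mul 2
  -- The upper bound for the boundary error is exactly `2 * (1/2)^n` times the lower bound for the
  -- plain error.
  have hO : (fun n => boundaryApprox n - ∑' n : ℕ, 1 / (n : ℝ) ^ 3) =O[atTop]
      (fun n => 2 * ((1 : ℝ) / 2) ^ n * (plainApprox n - ∑' n : ℕ, 1 / (n : ℝ) ^ 3)) := by
    refine IsBigO.of_bound' (.of_forall fun n => ?_)
    have h1 := abs_boundaryApprox_sub_le n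
    have h2 := plainApprox_lower_bound n
    have h0 : (0 : ℝ) ≤ 2 * (1 / 2) ^ n := by positivity
    rw [norm_mul, Real.norm_of_nonneg h0, Real.norm_eq_abs, Real.norm_eq_abs,
      abs_sub_comm (plainApprox n)]
    have h3 := mul_le_mul_of_nonneg_left (h2.trans (le_abs_self _)) h0
    refine h1.trans (le_trans (le_of_eq ?_) h3)
    field_simp
  simpa using hO.trans_isLittleO (hpow.mul_isBigO (isBigO_refl _ _))

/-- Since no plain approximation equals `ζ(3)`, the little-o relation says exactly that the quotient
of errors tends to 0. -/
theorem mainTheorem5 :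
    dirichletEta 1 = Real.log 2 ∧
    Tendsto (fun n : ℕ => (boundaryApprox n : ℂ)) atTop (𝓝 (riemannZeta 3)) ∧
    Summable (fun j : ℕ+ => 1 / (((j : ℝ) + 1) * ((j : ℝ) + 2)) * dirichletEta j) ∧
    riemannZeta 3 =
      ((2 / 7 * Real.pi ^ 2 *
        ∑' j : ℕ+, 1 / (((j : ℝ) + 1) * ((j : ℝ) + 2)) * dirichletEta j : ℝ) : ℂ) ∧
    (∀ n : ℕ, (plainApprox n : ℂ) ≠ riemannZeta 3) ∧
    (fun n : ℕ => (boundaryApprox n : ℂ) - riemannZeta 3) =o[atTop]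
      (fun n : ℕ => (plainApprox n : ℂ) - riemannZeta 3) := by
  have hshift : ∀ j : ℕ, 1 / ((((j + 1 : ℕ) : ℝ) + 1) * (((j + 1 : ℕ) : ℝ) + 2)) *
      dirichletEta ((j + 1 : ℕ) : ℝ) =
      1 / (((j : ℝ) + 2) * (j + 3)) * dirichletEta ((j + 1 : ℕ) : ℝ) := by
    intro j
    push_cast
    ring_nf
  refine ⟨dirichletEta_one, ?_, ?_, ?_, fun n hn => ?_, ?_⟩
  · rw [riemannZeta_three]
    exact (Complex.continuous_ofReal.tendsto _).comp tendsto_boundaryApprox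
  · rw [summable_pnat_iff_summable_succ
      (f := fun j : ℕ => 1 / (((j : ℝ) + 1) * ((j : ℝ) + 2)) * dirichletEta j)]
    simpa only [hshift] using summable_dirichletEta_mul
  · rw [riemannZeta_three, ← two_sevenths_pi_sq_mul_tsum, tsum_pnat_eq_tsum_succ
      (f := fun j : ℕ => 1 / (((j : ℝ) + 1) * ((j : ℝ) + 2)) * dirichletEta j)]
    simp only [hshift]
  · rw [riemannZeta_three, Complex.ofReal_inj] at hn
    have h := plainApprox_lower_bound n
    rw [hn, sub_self] at h
    exact absurd h (not_le.2 (by positivity))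
  · rw [riemannZeta_three]
    refine IsLittleO.of_norm_norm ?_
    simp only [← Complex.ofReal_sub, Complex.norm_real]
    exact boundaryApprox_sub_isLittleO.norm_norm
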